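/- **Setting.** Let $H$ be a Hermitian $n\times n$ matrix ($n\ge 2$) encoding a graph on the nodes $\{1,\dots,n\}$, with eigenvalues $0\le\lambda_1\le\dots\le\lambda_{n-1}<\lambda_n=1$ and orthonormal eigenvectors $|v_1\rangle,\dots,|v_n\rangle$. Let $w$ be a marked node and write $|w\rangle=\sum_i a_i|v_i\rangle$. Put $\epsilon=|a_n|^2=|\langle w|v_n\rangle|^2$, assumed non-zero, $\Delta=1-\lambda_{n-1}$, and, for integers $k\ge 1$, $S_k=\sum_{i=1}^{n-1}|a_i|^2/(1-\lambda_i)^k$. The spectral condition with constant $c>0$ is $$\sqrt{\epsilon}<c\,\min\left\{\frac{S_1S_2}{S_3},\ \Delta\sqrt{S_2}\right\}.$$ The $\mathcal{CG}$ spatial search algorithm with parameters $r>0$ and $T\ge 0$ starts in the $1$-eigenstate $|v_n\rangle$ of $H$ and evolves it for time $T$ under $H_{\mathrm{search}}=|w\rangle\langle w|+rH$; its overlap with the marked node is $\left|\langle w|e^{-iH_{\mathrm{search}}T}|v_n\rangle\right|$. On a sequence of instances $(H,w)$, the algorithm is called optimal if $r>0$ and $T\ge 0$ can be chosen for each instance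 in such a way that $T=\Theta(1/\sqrt{\epsilon})$ and the overlap is $\Theta(1)$ along the sequence. **Theorem (optimality of quantum search).** There is an absolute constant $c_0>0$ such that the following holds for every $0<c\le c_0$. For every sequence of instances $(H,w)$ that all satisfy the spectral condition with constant $c$, the $\mathcal{CG}$ algorithm is optimal if and only if $S_1/\sqrt{S_2}=\Theta(1)$ along the sequence. -/

import Mathlib

open Filter Asymptotics

noncomputable section

namespace SpatialSearch

/-- A search instance: a Hermitian matrix `H` on the node set `Fin n`, a marked node `w`, and a
spectral decomposition `H v_i = lam_i v_i` in an orthonormal basis, with the eigenvalues in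
nondecreasing order in `[0, 1]`, the largest one equal to `1` and simple. (For `n < 2` there is no
second largest eigenvalue.) -/
structure SearchInstance where
  n : ℕ
  two_le : 2 ≤ n
  H : Matrix (Fin n) (Fin n) ℂ
  hermitian : H.IsHermitian
  w : Fin n
  lam : Fin n → ℝ
  v : OrthonormalBasis (Fin n) ℂ (EuclideanSpace ℂ (Fin n))
  eigen : ∀ i, H.toEuclideanLin (v i) = (lam i : ℂ) • v i
  lam_mono : Monotone lam
  lam_nonneg : ∀ i, 0 ≤ lam i
  lam_last : lam ⟨n - 1, by omega⟩ = 1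
  lam_second_lt : lam ⟨n - 2, by omega⟩ < 1

namespace SearchInstance

variable (X : SearchInstance)

/-- The index of the largest eigenvalue. -/
def last : Fin X.n := ⟨X.n - 1, by have := X.two_le; omega⟩

/-- The index of the second largest eigenvalue. -/
def second : Fin X.n := ⟨X.n - 2, by have := X.two_le; omega⟩

/-- The basis state of the marked node. -/
def ket : EuclideanSpace ℂ (Fin X.n) := EuclideanSpace.single X.w 1

/-- The coefficient `a_i` of the marked state in the eigenbasis. -/
def a (i : Fin X.n) : ℂ := inner ℂ (X.v i) X.ket

/-- The squared overlap of the `1`-eigenstate with the marked state. -/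
def eps : ℝ := ‖X.a X.last‖ ^ 2

/-- The spectral gap. -/
def gap : ℝ := 1 - X.lam X.second

/-- `S_k`, the sum over all eigenvalues except the largest. -/
def S (k : ℕ) : ℝ := ∑ i ∈ Finset.univ.erase X.last, ‖X.a i‖ ^ 2 / (1 - X.lam i) ^ k

/-- The spectral condition with constant `c`. -/
def SpectralCondition (c : ℝ) : Prop :=
  √X.eps < c * min (X.S 1 * X.S 2 / X.S 3) (X.gap * √(X.S 2))

/-- The search Hamiltonian `|w⟩⟨w| + r H`. -/
def searchHamiltonian (r : ℝ) : Matrix (Fin X.n) (Fin X.n) ℂ :=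
  Matrix.single X.w X.w 1 + (r : ℂ) • X.H

/-- The state obtained from the `1`-eigenstate of `H` by evolving under the search Hamiltonian
for time `T`. -/
def finalState (r T : ℝ) : EuclideanSpace ℂ (Fin X.n) :=
  (NormedSpace.exp ((-(Complex.I * (T : ℂ))) • X.searchHamiltonian r)).toEuclideanLin (X.v X.last)

/-- The overlap `|⟨w|Ψ(T)⟩|` of the final state with the marked state. -/
def overlap (r T : ℝ) : ℝ := ‖(inner ℂ X.ket (X.finalState r T) : ℂ)‖

end SearchInstance

/-- The algorithm is optimal on a sequence of instances: for a suitable choice of `r > 0` in each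
instance, it reaches an overlap `Θ(1)` with the marked state after a time `Θ(1 / √ε)`. -/
def IsOptimal (X : ℕ → SearchInstance) : Prop :=
  ∃ r T : ℕ → ℝ, (∀ k, 0 < r k) ∧ (∀ k, 0 ≤ T k) ∧
    T =Θ[atTop] (fun k => 1 / √(X k).eps) ∧
    (fun k => (X k).overlap (r k) (T k)) =Θ[atTop] (fun _ => (1 : ℝ))

end SpatialSearch

end

/-!
Write `ρ = S₁ / √S₂`, which is at most `1` by Cauchy–Schwarz, and `yᵢ = 1 - λᵢ`. No diagonalization
of the search Hamiltonian `M = |w⟩⟨w| + rH` is needed: the evolution is compared with explicit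
vectors on which `M - r` acts in a controlled way, since `M - r` maps `u` to
`⟨w|u⟩ |w⟩ - r (1 - H) u`.

*Necessity of `ρ = Θ(1)`.* The evolution moves a vector `u`, up to a phase, by at most
`T ‖(M - r) u‖`. So the overlap is at most `‖vₙ - u‖ + |⟨w|u⟩| + T ‖(M - r) u‖` for every `u`
(`overlap_le_of_approx`). For `r ≤ 2 S₁`, take for `u` the initial state made orthogonal to `|w⟩`
along the vector with coordinates `aᵢ / (yᵢ (r yᵢ + √ε))` (`overlap_le_of_pos`); for `r ≥ 2 S₁`, take
the first-order perturbation of `vₙ` (`overlap_le_of_two_mul_le`). Together with the bound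
`√ε S₃ ≤ c S₁ S₂` from the spectral condition, both choices give an overlap `O(ρ)` for every
`T = O(1 / √ε)`, with a constant depending on `c` (`overlap_le`).

*Sufficiency.* Take `r = S₁` and `η = ρ √ε`. The equation `(η - i (M - r)) ζ = κ |w⟩` has an explicit
solution with `|κ| ≤ 2 √ε / ρ`, `‖ζ‖ ≤ 2 / ρ` and `|⟨ζ|vₙ⟩| = 1 / ρ` (`exists_resolvent`). The
function `e^{(-η + ir) t} ⟨ζ|e^{-iMt}|vₙ⟩` starts at modulus `1 / ρ`, is smaller than `1 / (2ρ)` at time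
`2 / (ρ √ε)`, and its derivative has modulus at most `|κ|` times the overlap at time `t`. Hence the
overlap cannot stay below `ρ / 16` between the times `1 / (8 √ε)` and `2 / (ρ √ε)`
(`exists_overlap_ge`).
-/

namespace SpatialSearch

/-! ### Unitary evolution generated by a Hermitian matrix -/

section Evolution

open scoped Matrix.Norms.L2Operator

variable {n : ℕ} {M : Matrix (Fin n) (Fin n) ℂ}

/-- The Schrödinger evolution `e^{-iMt} u`. -/
noncomputable def evolve (M : Matrix (Fin n) (Fin n) ℂ) (t : ℝ)
    (u : EuclideanSpace ℂ (Fin n)) : EuclideanSpace ℂ (Fin n) :=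
  (NormedSpace.exp ((-(Complex.I * (t : ℂ))) • M)).toEuclideanLin u

lemma evolve_zero (u : EuclideanSpace ℂ (Fin n)) : evolve M 0 u = u := by
  simp [evolve, Matrix.toEuclideanLin]

lemma norm_evolve (hM : M.IsHermitian) (t : ℝ) (u : EuclideanSpace ℂ (Fin n)) :
    ‖evolve M t u‖ = ‖u‖ := by
  have hU : (NormedSpace.exp ((-(Complex.I * (t : ℂ))) • M)).conjTranspose
      * NormedSpace.exp ((-(Complex.I * (t : ℂ))) • M) = 1 := by
    have hskew : ((-(Complex.I * (t : ℂ))) • M).conjTranspose = -((-(Complex.I * (t : ℂ))) • M) := by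
      rw [Matrix.conjTranspose_smul, hM.eq]
      simp
    rw [← Matrix.exp_conjTranspose, hskew, Matrix.exp_neg]
    exact Matrix.nonsing_inv_mul _ ((Matrix.isUnit_iff_isUnit_det _).mp (Matrix.isUnit_exp _))
  have h : inner ℂ (evolve M t u) (evolve M t u) = inner ℂ u u := by
    rw [evolve, ← LinearMap.adjoint_inner_right, ← Matrix.toEuclideanLin_conjTranspose_eq_adjoint]
    congr 1
    rw [Matrix.toLpLin_apply, Matrix.toLpLin_apply, Matrix.mulVec_mulVec, hU]
    simp
  rw [@norm_eq_sqrt_re_inner ℂ, h, ← @norm_eq_sqrt_re_inner ℂ]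

lemma evolve_sub (t : ℝ) (u v : EuclideanSpace ℂ (Fin n)) :
    evolve M t (u - v) = evolve M t u - evolve M t v := map_sub _ _ _

lemma hasDerivAt_exp_neg_I_smul (M : Matrix (Fin n) (Fin n) ℂ) (t : ℝ) :
    HasDerivAt (fun s : ℝ => NormedSpace.exp ((-(Complex.I * (s : ℂ))) • M))
      (NormedSpace.exp ((-(Complex.I * (t : ℂ))) • M) * (-Complex.I • M)) t := by
  have h := hasDerivAt_exp_smul_const (𝕂 := ℝ) (-Complex.I • M) t
  have e : ∀ s : ℝ, s • (-Complex.I • M) = (-(Complex.I * (s : ℂ))) • M := fun s => by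
    rw [← Complex.coe_smul, smul_smul]; ring_nf
  simpa only [e] using h

lemma hasDerivAt_evolve (M : Matrix (Fin n) (Fin n) ℂ) (t : ℝ) (u : EuclideanSpace ℂ (Fin n)) :
    HasDerivAt (fun s : ℝ => evolve M s u)
      (evolve M t (-Complex.I • M.toEuclideanLin u)) t := by
  let L : Matrix (Fin n) (Fin n) ℂ →ₗ[ℝ] EuclideanSpace ℂ (Fin n) :=
    { toFun := fun A => A.toEuclideanLin u
      map_add' := fun A B => by simp
      map_smul' := fun c A => by
        rw [← Complex.coe_smul, map_smul]; simp }
  have h := (LinearMap.toContinuousLinearMap L).hasFDerivAt.comp_hasDerivAt t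
    (hasDerivAt_exp_neg_I_smul M t)
  refine h.congr_deriv ?_
  change (NormedSpace.exp ((-(Complex.I * (t : ℂ))) • M) * (-Complex.I • M)).toEuclideanLin u = _
  rw [evolve, Matrix.toLpLin_apply, Matrix.toLpLin_apply,
    ← Matrix.mulVec_mulVec, Matrix.smul_mulVec, Matrix.toLpLin_apply]
  simp

/-- The evolution commutes with its generator. -/
lemma evolve_toEuclideanLin (M : Matrix (Fin n) (Fin n) ℂ) (t : ℝ)
    (u : EuclideanSpace ℂ (Fin n)) :
    evolve M t (M.toEuclideanLin u) = M.toEuclideanLin (evolve M t u) := by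
  have hc : Commute (NormedSpace.exp ((-(Complex.I * (t : ℂ))) • M)) M :=
    Commute.exp_left ((Commute.refl M).smul_left _)
  simp only [evolve, Matrix.toLpLin_apply, Matrix.mulVec_mulVec, hc.eq]

/-- An approximate eigenvector with eigenvalue `r` is moved, up to the phase `e^{-irt}`, by at most
the time multiplied by its defect. -/
lemma norm_phase_smul_evolve_sub_le (hM : M.IsHermitian) (r : ℝ) {T : ℝ} (hT : 0 ≤ T)
    (u : EuclideanSpace ℂ (Fin n)) :
    ‖Complex.exp (Complex.I * r * T) • evolve M T u - u‖
      ≤ T * ‖M.toEuclideanLin u - (r : ℂ) • u‖ := by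
  have hd : ∀ t : ℝ, HasDerivAt (fun s : ℝ => Complex.exp (Complex.I * r * s) • evolve M s u)
      (Complex.exp (Complex.I * r * t) •
        evolve M t (-Complex.I • (M.toEuclideanLin u - (r : ℂ) • u))) t := fun t => by
    have h1 : HasDerivAt (fun s : ℝ => Complex.exp (Complex.I * r * s))
        (Complex.exp (Complex.I * r * t) * (Complex.I * r)) t := by
      simpa using ((hasDerivAt_id t).ofReal_comp.const_mul (Complex.I * r)).cexp
    refine (h1.smul (hasDerivAt_evolve M t u)).congr_deriv ?_
    have h2 : evolve M t (-Complex.I • (M.toEuclideanLin u - (r : ℂ) • u))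
        = evolve M t (-Complex.I • M.toEuclideanLin u) + (Complex.I * r) • evolve M t u := by
      rw [show -Complex.I • (M.toEuclideanLin u - (r : ℂ) • u)
        = -Complex.I • M.toEuclideanLin u + (Complex.I * r) • u by module]
      exact (map_add _ _ _).trans (congrArg _ (map_smul _ _ _))
    rw [h2]
    module
  have h := norm_image_sub_le_of_norm_deriv_le_segment' (a := 0) (b := T)
    (C := ‖M.toEuclideanLin u - (r : ℂ) • u‖) (fun t _ => (hd t).hasDerivWithinAt)
    (fun t _ => by
      rw [norm_smul, norm_evolve hM, norm_smul]
      have : Complex.I * r * t = ((r * t : ℝ) : ℂ) * Complex.I := by push_cast; ring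
      rw [this, Complex.norm_exp_ofReal_mul_I]; simp) T ⟨hT, le_rfl⟩
  simpa [evolve_zero, mul_comm] using h

/-- If `ζ` solves `(iM + z̄) ζ = b`, then `e^{zt} ⟨ζ, e^{-iMt} u⟩` has derivative
`e^{zt} ⟨b, e^{-iMt} u⟩`. -/
lemma hasDerivAt_exp_mul_inner_evolve (hM : M.IsHermitian) {z : ℂ}
    {ζ b : EuclideanSpace ℂ (Fin n)}
    (hζ : Complex.I • M.toEuclideanLin ζ + (starRingEnd ℂ z) • ζ = b)
    (u : EuclideanSpace ℂ (Fin n)) (t : ℝ) :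
    HasDerivAt (fun s : ℝ => Complex.exp (z * s) * inner ℂ ζ (evolve M s u))
      (Complex.exp (z * t) * inner ℂ b (evolve M t u)) t := by
  have h1 : HasDerivAt (fun s : ℝ => Complex.exp (z * s)) (Complex.exp (z * t) * z) t := by
    simpa using ((hasDerivAt_id t).ofReal_comp.const_mul z).cexp
  have h2 : HasDerivAt (fun s : ℝ => inner ℂ ζ (evolve M s u))
      (inner ℂ ζ (evolve M t (-Complex.I • M.toEuclideanLin u))) t := by
    simpa using (hasDerivAt_const t ζ).inner ℂ (hasDerivAt_evolve M t u)
  refine (h1.mul h2).congr_deriv ?_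
  have hs : ∀ x y : EuclideanSpace ℂ (Fin n),
      inner ℂ x (M.toEuclideanLin y) = inner ℂ (M.toEuclideanLin x) y := fun x y =>
    ((Matrix.isSymmetric_toEuclideanLin_iff.mpr hM) x y).symm
  have hl : evolve M t (-Complex.I • M.toEuclideanLin u)
      = -Complex.I • M.toEuclideanLin (evolve M t u) := by
    rw [← evolve_toEuclideanLin]; exact map_smul _ _ _
  rw [hl, inner_smul_right, hs, ← hζ, inner_add_left, inner_smul_left, inner_smul_left]
  simp
  ring

end Evolution

namespace SearchInstance

variable (X : SearchInstance)

/-! ### Coordinates in the eigenbasis -/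

lemma one_sub_lam_pos_of_ne {i : Fin X.n} (hi : i ≠ X.last) : 0 < 1 - X.lam i := by
  have hle : i ≤ X.second := by
    have h1 : i.val ≠ X.n - 1 := fun h => hi (Fin.ext h)
    have h2 := i.isLt
    rw [Fin.le_def]
    simp only [second]
    omega
  have h1 := X.lam_mono hle
  have h2 := X.lam_second_lt
  simp only [second] at h1
  linarith

lemma one_sub_lam_pos {i : Fin X.n} (hi : i ∈ Finset.univ.erase X.last) : 0 < 1 - X.lam i :=
  X.one_sub_lam_pos_of_ne (Finset.ne_of_mem_erase hi)

/-- The vector with coordinates `c i` in the eigenbasis, apart from a vanishing component along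
the `1`-eigenstate. -/
noncomputable def bulk (c : Fin X.n → ℂ) : EuclideanSpace ℂ (Fin X.n) :=
  ∑ i ∈ Finset.univ.erase X.last, c i • X.v i

lemma ket_eq : X.ket = X.a X.last • X.v X.last + X.bulk X.a := by
  rw [bulk, Finset.add_sum_erase _ (fun i => X.a i • X.v i) (Finset.mem_univ _)]
  exact (X.v.sum_repr' X.ket).symm

lemma inner_ket_v (i : Fin X.n) : inner ℂ X.ket (X.v i) = starRingEnd ℂ (X.a i) :=
  (inner_conj_symm _ _).symm

lemma inner_ket_bulk (c : Fin X.n → ℂ) :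
    inner ℂ X.ket (X.bulk c) = ∑ i ∈ Finset.univ.erase X.last, starRingEnd ℂ (X.a i) * c i := by
  simp only [bulk, inner_sum, inner_smul_right, inner_ket_v]
  exact Finset.sum_congr rfl fun i _ => mul_comm _ _

lemma norm_bulk_sq (c : Fin X.n → ℂ) :
    ‖X.bulk c‖ ^ 2 = ∑ i ∈ Finset.univ.erase X.last, ‖c i‖ ^ 2 := by
  rw [@norm_sq_eq_re_inner ℂ, bulk, X.v.orthonormal.inner_sum]
  simp only [RCLike.re_to_complex, Complex.re_sum]
  refine Finset.sum_congr rfl fun i _ => ?_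
  rw [mul_comm, Complex.mul_conj, Complex.normSq_eq_norm_sq, Complex.ofReal_re]

lemma bulk_smul (z : ℂ) (c : Fin X.n → ℂ) : X.bulk (fun i => z * c i) = z • X.bulk c := by
  simp only [bulk, mul_smul, Finset.smul_sum]

lemma S_nonneg (k : ℕ) : 0 ≤ X.S k :=
  Finset.sum_nonneg fun _ hi => div_nonneg (sq_nonneg _) (pow_nonneg (X.one_sub_lam_pos hi).le _)

lemma norm_bulk_le {c : Fin X.n → ℂ} {K : ℝ} (hK : 0 ≤ K)
    (hc : ∀ i ∈ Finset.univ.erase X.last, ‖c i‖ ≤ K * (‖X.a i‖ / (1 - X.lam i))) :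
    ‖X.bulk c‖ ≤ K * √(X.S 2) := by
  refine le_of_sq_le_sq ?_ (by positivity)
  rw [norm_bulk_sq, mul_pow, Real.sq_sqrt (X.S_nonneg 2), S, Finset.mul_sum]
  refine Finset.sum_le_sum fun i hi => ?_
  calc ‖c i‖ ^ 2 ≤ (K * (‖X.a i‖ / (1 - X.lam i))) ^ 2 :=
        pow_le_pow_left₀ (norm_nonneg _) (hc i hi) 2
    _ = _ := by rw [mul_pow, div_pow]

lemma norm_v (i : Fin X.n) : ‖X.v i‖ = 1 := X.v.orthonormal.1 i

lemma norm_ket : ‖X.ket‖ = 1 := by simp [ket]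

lemma sqrt_eps : √X.eps = ‖X.a X.last‖ := Real.sqrt_sq (norm_nonneg _)

lemma eps_add_sum : X.eps + ∑ i ∈ Finset.univ.erase X.last, ‖X.a i‖ ^ 2 = 1 := by
  rw [eps, Finset.add_sum_erase _ (fun i => ‖X.a i‖ ^ 2) (Finset.mem_univ _)]
  have h := X.v.sum_sq_norm_inner_right X.ket
  rw [norm_ket] at h
  simpa [a] using h

/-! ### Moments of the marked state -/

lemma S_one_sq_le : X.S 1 ^ 2 ≤ X.S 2 := by
  have h := Finset.sum_sq_le_sum_mul_sum_of_sq_le_mul (Finset.univ.erase X.last)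
    (r := fun i => ‖X.a i‖ ^ 2 / (1 - X.lam i) ^ 1) (f := fun i => ‖X.a i‖ ^ 2)
    (g := fun i => ‖X.a i‖ ^ 2 / (1 - X.lam i) ^ 2) (fun i _ => by positivity)
    (fun i _ => by positivity) (fun i _ => le_of_eq (by rw [div_pow]; ring))
  have h1 : 0 ≤ X.eps := sq_nonneg _
  have h2 := X.eps_add_sum
  exact h.trans (mul_le_of_le_one_left (X.S_nonneg 2) (by linarith))

lemma S_two_sq_le : X.S 2 ^ 2 ≤ X.S 1 * X.S 3 := by
  refine Finset.sum_sq_le_sum_mul_sum_of_sq_le_mul _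
    (fun i hi => ?_) (fun i hi => ?_) (fun i hi => le_of_eq ?_)
  all_goals have := X.one_sub_lam_pos hi
  · positivity
  · positivity
  · field_simp

lemma S_one_le : X.S 1 ≤ √(X.S 2) := Real.le_sqrt_of_sq_le X.S_one_sq_le

/-! ### The search Hamiltonian in the eigenbasis -/

lemma isHermitian_searchHamiltonian (r : ℝ) : (X.searchHamiltonian r).IsHermitian := by
  refine Matrix.IsHermitian.add ?_ ?_
  · simp [Matrix.IsHermitian, Matrix.conjTranspose_single]
  · rw [Matrix.IsHermitian, Matrix.conjTranspose_smul, X.hermitian.eq]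
    simp

lemma searchHamiltonian_apply (r : ℝ) (u : EuclideanSpace ℂ (Fin X.n)) :
    (X.searchHamiltonian r).toEuclideanLin u
      = (inner ℂ X.ket u : ℂ) • X.ket + (r : ℂ) • X.H.toEuclideanLin u := by
  have hk : inner ℂ X.ket u = u X.w := by
    rw [ket, EuclideanSpace.inner_single_left]
    simp
  rw [searchHamiltonian, map_add, map_smul, LinearMap.add_apply, LinearMap.smul_apply, hk]
  congr 1
  rw [Matrix.toLpLin_apply, Matrix.single_mulVec]
  ext j
  simp [ket, Function.update_apply]

lemma lam_last_eq : X.lam X.last = 1 := X.lam_last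

/-- `H_search - r` is the rank-one term `|w⟩⟨w|` minus `r (1 - H)`, and `1 - H` annihilates the
`1`-eigenstate. -/
lemma searchHamiltonian_sub_smul (r : ℝ) (α : ℂ) (c : Fin X.n → ℂ) :
    (X.searchHamiltonian r).toEuclideanLin (α • X.v X.last + X.bulk c)
        - (r : ℂ) • (α • X.v X.last + X.bulk c)
      = (inner ℂ X.ket (α • X.v X.last + X.bulk c) : ℂ) • X.ket
        - X.bulk (fun i => r * (1 - X.lam i) * c i) := by
  have h : X.H.toEuclideanLin (α • X.v X.last + X.bulk c)
      = α • X.v X.last + X.bulk (fun i => X.lam i * c i) := by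
    rw [map_add, map_smul, X.eigen, lam_last_eq, bulk, map_sum, bulk]
    simp only [map_smul, X.eigen, smul_smul, Complex.ofReal_one, mul_one, mul_comm]
  have h' : X.bulk (fun i => r * (1 - X.lam i) * c i)
      = (r : ℂ) • X.bulk c - (r : ℂ) • X.bulk (fun i => X.lam i * c i) := by
    rw [← smul_sub, bulk, bulk, bulk, ← Finset.sum_sub_distrib, Finset.smul_sum]
    refine Finset.sum_congr rfl fun i _ => ?_
    module
  rw [searchHamiltonian_apply, h, h']
  module

lemma inner_ket_add_bulk (α : ℂ) (c : Fin X.n → ℂ) :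
    inner ℂ X.ket (α • X.v X.last + X.bulk c)
      = α * starRingEnd ℂ (X.a X.last)
        + ∑ i ∈ Finset.univ.erase X.last, starRingEnd ℂ (X.a i) * c i := by
  rw [inner_add_right, inner_smul_right, inner_ket_v, inner_ket_bulk]

lemma overlap_eq (r T : ℝ) :
    X.overlap r T = ‖(inner ℂ X.ket (evolve (X.searchHamiltonian r) T (X.v X.last)) : ℂ)‖ := rfl

lemma overlap_nonneg (r T : ℝ) : 0 ≤ X.overlap r T := norm_nonneg _

lemma norm_inner_ket_le (u : EuclideanSpace ℂ (Fin X.n)) : ‖(inner ℂ X.ket u : ℂ)‖ ≤ ‖u‖ := by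
  simpa [norm_ket] using norm_inner_le_norm (𝕜 := ℂ) X.ket u

lemma overlap_le_one (r T : ℝ) : X.overlap r T ≤ 1 := by
  refine (X.norm_inner_ket_le _).trans_eq ?_
  exact (norm_evolve (X.isHermitian_searchHamiltonian r) T _).trans (X.norm_v _)

/-! ### Upper bounds on the overlap -/

/-- The overlap is small as soon as the initial state is close to an approximate eigenvector `u` of
the search Hamiltonian that has small overlap with the marked state. -/
lemma overlap_le_of_approx (r : ℝ) {T : ℝ} (hT : 0 ≤ T) (u : EuclideanSpace ℂ (Fin X.n)) :
    X.overlap r T ≤ ‖X.v X.last - u‖ + ‖(inner ℂ X.ket u : ℂ)‖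
      + T * ‖(X.searchHamiltonian r).toEuclideanLin u - (r : ℂ) • u‖ := by
  have hM := X.isHermitian_searchHamiltonian r
  set M := X.searchHamiltonian r with hMdef
  set φ := Complex.exp (Complex.I * r * T) with hφ
  have hφn : ‖φ‖ = 1 := by
    have : Complex.I * r * T = ((r * T : ℝ) : ℂ) * Complex.I := by push_cast; ring
    rw [hφ, this, Complex.norm_exp_ofReal_mul_I]
  have h1 := norm_phase_smul_evolve_sub_le hM r hT u
  have h2 : ‖(inner ℂ X.ket (evolve M T (X.v X.last - u)) : ℂ)‖ ≤ ‖X.v X.last - u‖ :=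
    (X.norm_inner_ket_le _).trans_eq (norm_evolve hM T _)
  have h3 : ‖(inner ℂ X.ket (evolve M T u) : ℂ)‖
      = ‖(inner ℂ X.ket u : ℂ) + inner ℂ X.ket (φ • evolve M T u - u)‖ := by
    rw [inner_sub_right, inner_smul_right, add_sub_cancel, norm_mul, hφn, one_mul]
  have h4 := norm_add_le (inner ℂ X.ket u : ℂ) (inner ℂ X.ket (φ • evolve M T u - u))
  have h5 := X.norm_inner_ket_le (φ • evolve M T u - u)
  have h6 : X.overlap r T ≤ ‖(inner ℂ X.ket (evolve M T (X.v X.last - u)) : ℂ)‖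
      + ‖(inner ℂ X.ket (evolve M T u) : ℂ)‖ := by
    rw [overlap_eq]
    refine le_trans (le_of_eq ?_) (norm_add_le _ _)
    rw [← inner_add_right, evolve_sub, sub_add_cancel]
  linarith

lemma conj_mul_self (z : ℂ) : starRingEnd ℂ z * z = ((‖z‖ ^ 2 : ℝ) : ℂ) := by
  rw [mul_comm, Complex.mul_conj, Complex.normSq_eq_norm_sq]

/-- Bound for `r` up to a constant times `S₁`. The approximate eigenvector is the initial state
corrected, so as to be orthogonal to the marked state, along the vector with coordinates
`aᵢ / (yᵢ (r yᵢ + √ε))`, where `yᵢ = 1 - λᵢ`. -/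
lemma overlap_le_of_pos {r T : ℝ} (hr : 0 < r) (hT : 0 ≤ T) (hε : 0 < X.eps) (hS : 0 < X.S 2) :
    X.overlap r T ≤ (1 + √X.eps * T) * ((r * X.S 2 + √X.eps * X.S 3) / (X.S 2 * √(X.S 2))) := by
  set t := √X.eps with ht
  have htpos : 0 < t := Real.sqrt_pos.mpr hε
  set R := Finset.univ.erase X.last with hR
  obtain ⟨D, hD⟩ : ∃ D : ℝ,
      D = ∑ i ∈ R, ‖X.a i‖ ^ 2 / ((1 - X.lam i) * (r * (1 - X.lam i) + t)) := ⟨_, rfl⟩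
  -- Cauchy–Schwarz bounds the overlap `D` of the correction with the marked state from below.
  have hDS : X.S 2 ^ 2 ≤ D * (r * X.S 2 + t * X.S 3) := by
    rw [hD, S, S, Finset.mul_sum, Finset.mul_sum, ← Finset.sum_add_distrib]
    refine Finset.sum_sq_le_sum_mul_sum_of_sq_le_mul _
      (fun i hi => ?_) (fun i hi => ?_) (fun i hi => le_of_eq ?_)
    all_goals have := X.one_sub_lam_pos hi
    · positivity
    · positivity
    · field_simp
  have hpos : 0 < r * X.S 2 + t * X.S 3 := by
    have := X.S_nonneg 3
    positivity
  have hDpos : 0 < D := by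
    by_contra h
    have h1 := mul_nonpos_of_nonpos_of_nonneg (not_lt.mp h) hpos.le
    have h2 := pow_pos hS 2
    linarith
  set β : ℂ := starRingEnd ℂ (X.a X.last) / D with hβ
  have hβn : ‖β‖ = t / D := by
    rw [hβ, norm_div, RCLike.norm_conj, Complex.norm_of_nonneg hDpos.le, ht, sqrt_eps]
  set c : Fin X.n → ℂ := fun i => -β * (X.a i / ((1 - X.lam i : ℝ) * (r * (1 - X.lam i) + t : ℝ)))
    with hc
  have hcn : ∀ i ∈ R, ‖c i‖ = t / D * (‖X.a i‖ / ((1 - X.lam i) * (r * (1 - X.lam i) + t))) := by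
    intro i hi
    have := X.one_sub_lam_pos hi
    rw [hc]
    simp only
    rw [norm_mul, norm_neg, hβn, norm_div, norm_mul, Complex.norm_of_nonneg this.le,
      Complex.norm_of_nonneg (by positivity)]
  have h0 : inner ℂ X.ket ((1 : ℂ) • X.v X.last + X.bulk c) = (0 : ℂ) := by
    rw [inner_ket_add_bulk]
    have : ∑ i ∈ R, starRingEnd ℂ (X.a i) * c i = -β * (D : ℂ) := by
      rw [hD, Complex.ofReal_sum, Finset.mul_sum]
      refine Finset.sum_congr rfl fun i _ => ?_
      rw [hc, Complex.ofReal_div, ← conj_mul_self]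
      push_cast
      ring
    rw [this, hβ]
    have : (D : ℂ) ≠ 0 := by exact_mod_cast hDpos.ne'
    field_simp
    ring
  have hmain := X.overlap_le_of_approx r hT ((1 : ℂ) • X.v X.last + X.bulk c)
  rw [searchHamiltonian_sub_smul, h0, one_smul, zero_smul, zero_sub, norm_neg, norm_zero,
    sub_add_cancel_left, norm_neg] at hmain
  have hb1 : ‖X.bulk c‖ ≤ (1 / D) * √(X.S 2) := by
    refine X.norm_bulk_le (by positivity) fun i hi => ?_
    have hy := X.one_sub_lam_pos hi
    rw [hcn i hi]
    calc t / D * (‖X.a i‖ / ((1 - X.lam i) * (r * (1 - X.lam i) + t)))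
        ≤ t / D * (‖X.a i‖ / ((1 - X.lam i) * t)) := by
          gcongr
          exact le_add_of_nonneg_left (by positivity)
      _ = _ := by field_simp
  have hb2 : ‖X.bulk (fun i => r * (1 - X.lam i) * c i)‖ ≤ (t / D) * √(X.S 2) := by
    refine X.norm_bulk_le (by positivity) fun i hi => ?_
    have hy := X.one_sub_lam_pos hi
    have e : (r * (1 - X.lam i) * c i : ℂ) = ((r * (1 - X.lam i) : ℝ) : ℂ) * c i := by
      push_cast; ring
    rw [e, norm_mul, hcn i hi, Complex.norm_of_nonneg (by positivity)]
    calc r * (1 - X.lam i) * (t / D * (‖X.a i‖ / ((1 - X.lam i) * (r * (1 - X.lam i) + t))))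
        = t / D * (‖X.a i‖ / (1 - X.lam i))
          * (r * (1 - X.lam i) / (r * (1 - X.lam i) + t)) := by field_simp
      _ ≤ t / D * (‖X.a i‖ / (1 - X.lam i)) * 1 := by
          gcongr
          exact (div_le_one (by positivity)).mpr (by linarith)
      _ = _ := mul_one _
  have hfin : √(X.S 2) / D ≤ (r * X.S 2 + t * X.S 3) / (X.S 2 * √(X.S 2)) := by
    rw [div_le_div_iff₀ hDpos (by positivity)]
    calc √(X.S 2) * (X.S 2 * √(X.S 2)) = X.S 2 * (√(X.S 2)) ^ 2 := by ring
      _ = X.S 2 ^ 2 := by rw [Real.sq_sqrt hS.le]; ring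
      _ ≤ _ := by linarith
  calc X.overlap r T ≤ (1 / D) * √(X.S 2) + 0 + T * ((t / D) * √(X.S 2)) := by
        refine hmain.trans ?_
        gcongr
    _ = (1 + t * T) * (√(X.S 2) / D) := by ring
    _ ≤ _ := by gcongr

/-- Bound for `r ≥ 2 S₁`. The approximate eigenvector is the initial state corrected to first order
in `1 / r`; only its component along the initial state survives in the defect. -/
lemma overlap_le_of_two_mul_le {r T : ℝ} (hr : 2 * X.S 1 ≤ r) (hT : 0 ≤ T) (hS : 0 < X.S 1) :
    X.overlap r T ≤ √X.eps * √(X.S 2) / X.S 1 + 2 * √X.eps * (1 + √X.eps * T) := by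
  have hr0 : 0 < r := by linarith
  have hrS : 0 < r - X.S 1 := by linarith
  set t := √X.eps with ht
  have ht0 : 0 ≤ t := Real.sqrt_nonneg _
  set R := Finset.univ.erase X.last with hR
  set γ : ℂ := starRingEnd ℂ (X.a X.last) * ((r / (r - X.S 1) : ℝ) : ℂ) with hγ
  have hγn : ‖γ‖ ≤ 2 * t := by
    rw [hγ, norm_mul, RCLike.norm_conj, Complex.norm_of_nonneg (by positivity), ← sqrt_eps, ← ht,
      mul_comm]
    gcongr
    rw [div_le_iff₀ hrS]
    linarith
  set c : Fin X.n → ℂ := fun i => γ * (X.a i / (r * (1 - X.lam i) : ℝ)) with hc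
  have h0 : inner ℂ X.ket ((1 : ℂ) • X.v X.last + X.bulk c) = γ := by
    rw [inner_ket_add_bulk]
    have : ∑ i ∈ R, starRingEnd ℂ (X.a i) * c i = γ * ((X.S 1 / r : ℝ) : ℂ) := by
      rw [S, Finset.sum_div, Complex.ofReal_sum, Finset.mul_sum]
      refine Finset.sum_congr rfl fun i _ => ?_
      rw [hc, Complex.ofReal_div, Complex.ofReal_div, ← conj_mul_self]
      push_cast
      rw [pow_one, div_div, mul_comm (1 - _ : ℂ)]
      ring
    rw [this, hγ]
    have h1 : (r : ℂ) ≠ 0 := by exact_mod_cast hr0.ne'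
    have h2 : (r : ℂ) - (X.S 1 : ℝ) ≠ 0 := by exact_mod_cast hrS.ne'
    push_cast
    field_simp
    ring
  have hdefect : (X.bulk fun i => r * (1 - X.lam i) * c i) = γ • X.bulk X.a := by
    rw [← bulk_smul]
    refine Finset.sum_congr rfl fun i hi => ?_
    have hy : (1 - X.lam i : ℂ) ≠ 0 := by exact_mod_cast (X.one_sub_lam_pos hi).ne'
    have h1 : (r : ℂ) ≠ 0 := by exact_mod_cast hr0.ne'
    rw [hc]
    congr 1
    push_cast
    field_simp
  have hmain := X.overlap_le_of_approx r hT ((1 : ℂ) • X.v X.last + X.bulk c)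
  rw [searchHamiltonian_sub_smul, h0, hdefect, ket_eq, smul_add, add_sub_cancel_right, one_smul,
    sub_add_cancel_left, norm_neg, smul_smul, norm_smul, norm_v, mul_one, norm_mul γ,
    ← sqrt_eps, ← ht] at hmain
  have hb : ‖X.bulk c‖ ≤ (2 * t / r) * √(X.S 2) := by
    refine X.norm_bulk_le (by positivity) fun i hi => ?_
    have hy := X.one_sub_lam_pos hi
    rw [hc]
    simp only
    rw [norm_mul, norm_div, Complex.norm_of_nonneg (by positivity)]
    calc ‖γ‖ * (‖X.a i‖ / (r * (1 - X.lam i))) ≤ 2 * t * (‖X.a i‖ / (r * (1 - X.lam i))) := by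
          gcongr
      _ = _ := by field_simp
  have hb' : (2 * t / r) * √(X.S 2) ≤ t * √(X.S 2) / X.S 1 := by
    rw [div_mul_eq_mul_div, div_le_div_iff₀ hr0 hS]
    have := mul_nonneg ht0 (Real.sqrt_nonneg (X.S 2))
    nlinarith
  calc X.overlap r T ≤ t * √(X.S 2) / X.S 1 + 2 * t + T * (2 * t * t) := by
        refine hmain.trans ?_
        gcongr
        exact hb.trans hb'
    _ = _ := by ring

lemma S_one_pos {c : ℝ} (hc : 0 < c) (h : X.SpectralCondition c) : 0 < X.S 1 := by
  refine (X.S_nonneg 1).lt_of_ne fun h1 => ?_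
  have h2 := lt_of_lt_of_le h (mul_le_mul_of_nonneg_left (min_le_left _ _) hc.le)
  rw [← h1, zero_mul, zero_div, mul_zero] at h2
  exact absurd h2 (Real.sqrt_nonneg _).not_gt

lemma sqrt_eps_mul_S_three_le {c : ℝ} (hc : 0 < c) (h : X.SpectralCondition c) :
    √X.eps * X.S 3 ≤ c * (X.S 1 * X.S 2) := by
  have h2 := lt_of_lt_of_le h (mul_le_mul_of_nonneg_left (min_le_left _ _) hc.le)
  rcases (X.S_nonneg 3).eq_or_lt with h3 | h3
  · rw [← h3, mul_zero]
    have := X.S_nonneg 1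
    have := X.S_nonneg 2
    positivity
  · rw [← mul_div_assoc, lt_div_iff₀ h3] at h2
    exact h2.le

lemma sqrt_eps_mul_S_two_le {c : ℝ} (hc : 0 < c) (h : X.SpectralCondition c) :
    √X.eps * X.S 2 ≤ c * X.S 1 ^ 2 := by
  have hS1 := X.S_one_pos hc h
  have hS2 : 0 < X.S 2 := lt_of_lt_of_le (by positivity) X.S_one_sq_le
  have h1 := X.sqrt_eps_mul_S_three_le hc h
  have h2 := X.S_two_sq_le
  refine le_of_mul_le_mul_right ?_ hS2
  calc √X.eps * X.S 2 * X.S 2 = √X.eps * X.S 2 ^ 2 := by ring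
    _ ≤ √X.eps * (X.S 1 * X.S 3) := by gcongr
    _ = X.S 1 * (√X.eps * X.S 3) := by ring
    _ ≤ X.S 1 * (c * (X.S 1 * X.S 2)) := by gcongr
    _ = _ := by ring

/-- Whatever `r`, the overlap reached in time `O(1 / √ε)` is `O(S₁ / √S₂)`. -/
lemma overlap_le {c C r T : ℝ} (hc : 0 < c) (h : X.SpectralCondition c) (hε : 0 < X.eps)
    (hr : 0 < r) (hT : 0 ≤ T) (hC : √X.eps * T ≤ C) :
    X.overlap r T ≤ (1 + C) * (2 + 3 * c) * (X.S 1 / √(X.S 2)) := by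
  have hS1 := X.S_one_pos hc h
  have hS2 : 0 < X.S 2 := lt_of_lt_of_le (by positivity) X.S_one_sq_le
  have hs := Real.sqrt_pos.mpr hS2
  have hss := Real.sq_sqrt hS2.le
  have ht : 0 ≤ √X.eps := Real.sqrt_nonneg _
  have hC0 : 0 ≤ C := le_trans (by positivity) hC
  have hρ : 0 < X.S 1 / √(X.S 2) := by positivity
  rcases le_total r (2 * X.S 1) with h2 | h2
  · have h3 := X.sqrt_eps_mul_S_three_le hc h
    calc X.overlap r T
        ≤ (1 + √X.eps * T) * ((r * X.S 2 + √X.eps * X.S 3) / (X.S 2 * √(X.S 2))) :=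
          X.overlap_le_of_pos hr hT hε hS2
      _ ≤ (1 + C) * ((2 * X.S 1 * X.S 2 + c * (X.S 1 * X.S 2)) / (X.S 2 * √(X.S 2))) := by
          have := X.S_nonneg 3
          gcongr
      _ = (1 + C) * (2 + c) * (X.S 1 / √(X.S 2)) := by field_simp
      _ ≤ _ := by gcongr; linarith
  · have h3 := X.sqrt_eps_mul_S_two_le hc h
    have h4 : √X.eps * √(X.S 2) / X.S 1 ≤ c * (X.S 1 / √(X.S 2)) := by
      rw [← mul_div_assoc, div_le_div_iff₀ hS1 hs]
      nlinarith
    have h5 : √X.eps ≤ c * (X.S 1 / √(X.S 2)) := by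
      rw [← mul_div_assoc, le_div_iff₀ hs]
      have h6 := X.S_one_le
      refine le_of_mul_le_mul_right ?_ hs
      calc √X.eps * √(X.S 2) * √(X.S 2) = √X.eps * X.S 2 := by rw [mul_assoc, ← sq, hss]
        _ ≤ c * X.S 1 ^ 2 := h3
        _ = c * X.S 1 * X.S 1 := by ring
        _ ≤ c * X.S 1 * √(X.S 2) := by gcongr
    calc X.overlap r T
        ≤ √X.eps * √(X.S 2) / X.S 1 + 2 * √X.eps * (1 + √X.eps * T) :=
          X.overlap_le_of_two_mul_le h2 hT hS1
      _ ≤ c * (X.S 1 / √(X.S 2)) + 2 * (c * (X.S 1 / √(X.S 2))) * (1 + C) := by gcongr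
      _ ≤ _ := by
          have := mul_pos hc hρ
          nlinarith [mul_nonneg hC0 this.le, mul_nonneg hC0 hρ.le]

/-! ### A lower bound on the overlap -/

/-- For `r = S₁` and `η > 0`, the resolvent equation `(η - i (H_search - r)) ζ = κ |w⟩` has an
explicit solution with `‖ζ‖ = O(√ε / η + √S₂ / S₁)` and `κ = O(ε / η + η S₂ / S₁²)`: the
bound on `κ` rests on `∑ |aᵢ|² / (r (1 - λᵢ)) = 1`, the sum running over all eigenvalues but the
largest, which is where the choice `r = S₁` enters. -/
lemma exists_resolvent (hS : 0 < X.S 1) {η : ℝ} (hη : 0 < η) :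
    ∃ (ζ : EuclideanSpace ℂ (Fin X.n)) (κ : ℂ),
      Complex.I • (X.searchHamiltonian (X.S 1)).toEuclideanLin ζ
        + starRingEnd ℂ (-η + Complex.I * X.S 1 : ℂ) • ζ = -κ • X.ket ∧
      ‖κ‖ ≤ X.eps / η + η * X.S 2 / X.S 1 ^ 2 ∧
      ‖ζ‖ ≤ √X.eps / η + √(X.S 2) / X.S 1 ∧
      ‖(inner ℂ ζ (X.v X.last) : ℂ)‖ = √X.eps / η := by
  set R := Finset.univ.erase X.last with hR
  obtain ⟨r, hr⟩ : ∃ r, r = X.S 1 := ⟨_, rfl⟩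
  rw [← hr] at hS ⊢
  have hη' : (η : ℂ) ≠ 0 := by exact_mod_cast hη.ne'
  have hr' : (r : ℂ) ≠ 0 := by exact_mod_cast hS.ne'
  have hre : ∀ y : ℝ, r * y ≤ ‖(η + Complex.I * (r * y) : ℂ)‖ := fun y => by
    refine (le_abs_self _).trans (le_trans (le_of_eq ?_) (Complex.abs_im_le_norm _))
    simp
  have hne : ∀ y : ℝ, (η + Complex.I * (r * y) : ℂ) ≠ 0 := fun y h => by
    have := congrArg Complex.re h
    simp at this
    exact hη.ne' this
  obtain ⟨c, hc⟩ : ∃ c : Fin X.n → ℂ,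
      ∀ i, c i = X.a i / (η + Complex.I * (r * (1 - X.lam i : ℝ))) := ⟨_, fun _ => rfl⟩
  obtain ⟨ζ, hζ⟩ : ∃ ζ, ζ = (X.a X.last / η) • X.v X.last + X.bulk c := ⟨_, rfl⟩
  obtain ⟨σ, hσ⟩ : ∃ σ : ℂ, σ = inner ℂ X.ket ζ := ⟨_, rfl⟩
  refine ⟨ζ, 1 - Complex.I * σ, ?_, ?_, ?_, ?_⟩
  · have h1 := X.searchHamiltonian_sub_smul r (X.a X.last / η) c
    rw [← hζ, ← hσ] at h1
    have h2 : X.ket = (η : ℂ) • ζ + Complex.I • X.bulk (fun i => r * (1 - X.lam i) * c i) := by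
      rw [ket_eq, hζ, smul_add, smul_smul, mul_div_cancel₀ _ hη', add_assoc, ← bulk_smul,
        ← bulk_smul, bulk, bulk, bulk, ← Finset.sum_add_distrib]
      congr 1
      refine Finset.sum_congr rfl fun i _ => ?_
      rw [← add_smul, hc]
      congr 1
      have := hne (1 - X.lam i)
      push_cast at this ⊢
      linear_combination -(mul_div_cancel₀ (X.a i) this)
    have h3 : starRingEnd ℂ (-η + Complex.I * r : ℂ) = -η - Complex.I * r := by
      simp [sub_eq_add_neg]
    rw [h3]
    calc Complex.I • (X.searchHamiltonian r).toEuclideanLin ζ + (-η - Complex.I * r : ℂ) • ζ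
        = Complex.I • ((X.searchHamiltonian r).toEuclideanLin ζ - (r : ℂ) • ζ) - (η : ℂ) • ζ := by
          module
      _ = (Complex.I * σ) • X.ket
          - ((η : ℂ) • ζ + Complex.I • X.bulk (fun i => r * (1 - X.lam i) * c i)) := by
          rw [h1]
          module
      _ = -(1 - Complex.I * σ) • X.ket := by
          rw [← h2]
          module
  · have h1 : (1 : ℂ) = ∑ i ∈ R, (((‖X.a i‖ ^ 2 / (1 - X.lam i) : ℝ)) : ℂ) / r := by
      rw [← Finset.sum_div, ← Complex.ofReal_sum]
      have : ∑ i ∈ R, ‖X.a i‖ ^ 2 / (1 - X.lam i) = r := by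
        rw [hr, S]
        simp [R]
      rw [this, div_self hr']
    have h2 : (1 - Complex.I * σ : ℂ) = -(Complex.I * X.eps / η)
        + ∑ i ∈ R, ((‖X.a i‖ ^ 2 / (1 - X.lam i) : ℝ) : ℂ) / r
          * (η / (η + Complex.I * (r * (1 - X.lam i : ℝ)))) := by
      rw [hσ, hζ, inner_ket_add_bulk, mul_add, Finset.mul_sum]
      conv_lhs => rw [h1]
      have e1 : (X.a X.last / η * starRingEnd ℂ (X.a X.last) : ℂ) = X.eps / η := by
        rw [div_mul_eq_mul_div, mul_comm, conj_mul_self, eps]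
      rw [e1, sub_add_eq_sub_sub_swap, ← Finset.sum_sub_distrib, sub_eq_neg_add, mul_div_assoc]
      congr 1
      refine Finset.sum_congr rfl fun i hi => ?_
      have hy : ((1 - X.lam i : ℝ) : ℂ) ≠ 0 := by exact_mod_cast (X.one_sub_lam_pos hi).ne'
      have := hne (1 - X.lam i)
      rw [hc, ← mul_div_assoc (starRingEnd ℂ (X.a i)), conj_mul_self, Complex.ofReal_div]
      obtain ⟨d, hd⟩ : ∃ d : ℂ, d = η + Complex.I * (r * (1 - X.lam i : ℝ)) := ⟨_, rfl⟩
      rw [← hd] at this ⊢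
      field_simp
      rw [hd]
      ring
    rw [h2]
    refine (norm_add_le _ _).trans (add_le_add (le_of_eq ?_) ?_)
    · rw [norm_neg, norm_div, norm_mul, Complex.norm_I, one_mul, Complex.norm_of_nonneg hη.le,
        Complex.norm_of_nonneg (show 0 ≤ X.eps from sq_nonneg _)]
    · rw [S, Finset.mul_sum, Finset.sum_div]
      refine norm_sum_le_of_le _ fun i hi => ?_
      have hy := X.one_sub_lam_pos hi
      rw [norm_mul, norm_div, norm_div, Complex.norm_of_nonneg (by positivity),
        Complex.norm_of_nonneg hS.le, Complex.norm_of_nonneg hη.le]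
      calc ‖X.a i‖ ^ 2 / (1 - X.lam i) / r * (η / ‖(η + Complex.I * (r * (1 - X.lam i : ℝ)) : ℂ)‖)
          ≤ ‖X.a i‖ ^ 2 / (1 - X.lam i) / r * (η / (r * (1 - X.lam i))) := by
            gcongr
            exact hre _
        _ = _ := by field_simp
  · rw [hζ]
    refine (norm_add_le _ _).trans (add_le_add (le_of_eq ?_) ?_)
    · rw [norm_smul, norm_v, mul_one, norm_div, Complex.norm_of_nonneg hη.le, sqrt_eps]
    · rw [div_eq_inv_mul]
      refine X.norm_bulk_le (by positivity) fun i hi => ?_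
      have hy := X.one_sub_lam_pos hi
      rw [hc, norm_div]
      calc ‖X.a i‖ / ‖(η + Complex.I * (r * (1 - X.lam i : ℝ)) : ℂ)‖
          ≤ ‖X.a i‖ / (r * (1 - X.lam i)) := by
            gcongr
            exact hre _
        _ = _ := by field_simp
  · have h1 : inner ℂ (X.bulk c) (X.v X.last) = (0 : ℂ) := by
      rw [bulk, sum_inner]
      refine Finset.sum_eq_zero fun i hi => ?_
      rw [inner_smul_left, X.v.orthonormal.2 (Finset.ne_of_mem_erase hi), mul_zero]
    rw [hζ, inner_add_left, h1, add_zero, inner_smul_left, inner_self_eq_norm_sq_to_K, norm_v]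
    simp [sqrt_eps, abs_of_pos hη]

/-- For `r = S₁` the overlap reaches a constant multiple of `ρ = S₁ / √S₂` at some time between
constant multiples of `1 / √ε` and `1 / (ρ √ε)`. -/
lemma exists_overlap_ge (hε : 0 < X.eps) (hS : 0 < X.S 1) :
    ∃ T : ℝ, 1 / 8 * (1 / √X.eps) ≤ T ∧ T ≤ 2 / (X.S 1 / √(X.S 2)) * (1 / √X.eps) ∧
      X.S 1 / √(X.S 2) / 16 ≤ X.overlap (X.S 1) T := by
  have hS2 : 0 < X.S 2 := lt_of_lt_of_le (by positivity) X.S_one_sq_le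
  have hs := Real.sqrt_pos.mpr hS2
  have hss := Real.sq_sqrt hS2.le
  have ht : 0 < √X.eps := Real.sqrt_pos.mpr hε
  have htt := Real.sq_sqrt hε.le
  obtain ⟨t, ht_def⟩ : ∃ t, t = √X.eps := ⟨_, rfl⟩
  obtain ⟨s, hs_def⟩ : ∃ s, s = √(X.S 2) := ⟨_, rfl⟩
  obtain ⟨ρ, hρ_def⟩ : ∃ ρ, ρ = X.S 1 / s := ⟨_, rfl⟩
  rw [← ht_def] at ht htt ⊢
  rw [← hs_def] at hs hss ⊢
  rw [← hρ_def]
  have hρ : 0 < ρ := by rw [hρ_def]; positivity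
  have hρ1 : ρ ≤ 1 := by
    rw [hρ_def, div_le_one hs, hs_def]
    exact X.S_one_le
  by_contra! hcon
  -- To leading order, `± ρ √ε` are the two eigenvalues of `H_search - r` closest to zero.
  obtain ⟨ζ, κ, heq, hκ, hζ, h0⟩ := X.exists_resolvent hS (mul_pos hρ ht)
  have hSs : X.S 1 = ρ * s := by rw [hρ_def]; field_simp
  have hκ' : ‖κ‖ ≤ 2 * t / ρ := by
    refine hκ.trans (le_of_eq ?_)
    rw [hSs, ← hss, ← htt]
    field_simp
    ring
  have hζ' : ‖ζ‖ ≤ 2 / ρ := by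
    refine hζ.trans (le_of_eq ?_)
    rw [← ht_def, ← hs_def, hSs]
    field_simp
    ring
  have h0' : ‖(inner ℂ ζ (X.v X.last) : ℂ)‖ = 1 / ρ := by
    rw [h0, ← ht_def]
    field_simp
  have hM := X.isHermitian_searchHamiltonian (X.S 1)
  have hnexp : ∀ x : ℝ, ‖Complex.exp ((-(ρ * t : ℝ) + Complex.I * X.S 1) * x)‖
      = Real.exp (-(ρ * t * x)) := fun x => by
    rw [Complex.norm_exp]
    simp
  set h : ℝ → ℂ := fun x => Complex.exp ((-(ρ * t : ℝ) + Complex.I * X.S 1) * x)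
    * inner ℂ ζ (evolve (X.searchHamiltonian (X.S 1)) x (X.v X.last)) with hh
  have hd : ∀ x : ℝ, HasDerivAt h (Complex.exp ((-(ρ * t : ℝ) + Complex.I * X.S 1) * x)
      * inner ℂ (-κ • X.ket) (evolve (X.searchHamiltonian (X.S 1)) x (X.v X.last))) x := fun x =>
    hasDerivAt_exp_mul_inner_evolve hM heq _ x
  have hdn : ∀ x : ℝ, 0 ≤ x → ‖Complex.exp ((-(ρ * t : ℝ) + Complex.I * X.S 1) * x)
      * inner ℂ (-κ • X.ket) (evolve (X.searchHamiltonian (X.S 1)) x (X.v X.last))‖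
      ≤ 2 * t / ρ * X.overlap (X.S 1) x := fun x hx => by
    rw [norm_mul, hnexp, inner_smul_left, norm_mul, RCLike.norm_conj, norm_neg, ← overlap_eq]
    have h1 : Real.exp (-(ρ * t * x)) ≤ 1 := Real.exp_le_one_iff.mpr (by
      have : 0 ≤ ρ * t * x := by positivity
      linarith)
    have h2 := X.overlap_nonneg (X.S 1) x
    calc Real.exp (-(ρ * t * x)) * (‖κ‖ * X.overlap (X.S 1) x)
        ≤ 1 * (2 * t / ρ * X.overlap (X.S 1) x) := by gcongr
      _ = _ := one_mul _
  set T₁ := 1 / 8 * (1 / t) with hT₁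
  set T₂ := 2 / ρ * (1 / t) with hT₂
  have hT₁0 : 0 ≤ T₁ := by positivity
  have hT₁₂ : T₁ ≤ T₂ := by
    rw [hT₁, hT₂]
    refine mul_le_mul_of_nonneg_right ?_ (by positivity)
    rw [le_div_iff₀ hρ]
    linarith
  have b1 := norm_image_sub_le_of_norm_deriv_le_segment' (a := 0) (b := T₁) (C := 2 * t / ρ)
    (fun x _ => (hd x).hasDerivWithinAt) (fun x hx => (hdn x hx.1).trans
      (mul_le_of_le_one_right (by positivity) (X.overlap_le_one _ _))) T₁ ⟨hT₁0, le_rfl⟩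
  have b2 := norm_image_sub_le_of_norm_deriv_le_segment' (a := T₁) (b := T₂)
    (C := 2 * t / ρ * (ρ / 16))
    (fun x _ => (hd x).hasDerivWithinAt) (fun x hx => (hdn x (hT₁0.trans hx.1)).trans
      (mul_le_mul_of_nonneg_left (hcon x hx.1 hx.2.le).le (by positivity))) T₂ ⟨hT₁₂, le_rfl⟩
  have b1' : 2 * t / ρ * (T₁ - 0) = 1 / 4 * (1 / ρ) := by
    rw [hT₁]
    field_simp
    norm_num
  have b2' : 2 * t / ρ * (ρ / 16) * (T₂ - T₁) ≤ 1 / 4 * (1 / ρ) := by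
    calc 2 * t / ρ * (ρ / 16) * (T₂ - T₁) ≤ 2 * t / ρ * (ρ / 16) * T₂ := by
          gcongr
          linarith
      _ = _ := by
          rw [hT₂]
          field_simp
          norm_num
  have hend0 : ‖h 0‖ = 1 / ρ := by
    simp only [hh]
    rw [evolve_zero, norm_mul, h0']
    simp
  have hexp : Real.exp (-2) < 1 / 4 := by
    rw [Real.exp_neg, inv_eq_one_div]
    refine one_div_lt_one_div_of_lt (by norm_num) ?_
    have h1 := Real.exp_one_gt_d9
    have h2 : Real.exp 2 = Real.exp 1 ^ 2 := by rw [← Real.exp_nat_mul]; norm_num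
    rw [h2]
    nlinarith
  have hend2 : ‖h T₂‖ < 1 / 2 * (1 / ρ) := by
    simp only [hh]
    rw [norm_mul, hnexp]
    have h1 : -(ρ * t * T₂) = -2 := by rw [hT₂]; field_simp
    have h2 := norm_inner_le_norm (𝕜 := ℂ) ζ
      (evolve (X.searchHamiltonian (X.S 1)) T₂ (X.v X.last))
    rw [norm_evolve hM, norm_v, mul_one] at h2
    rw [h1]
    calc Real.exp (-2) * ‖(inner ℂ ζ (evolve (X.searchHamiltonian (X.S 1)) T₂ (X.v X.last)) : ℂ)‖
        ≤ Real.exp (-2) * (2 / ρ) := by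
          gcongr
          exact h2.trans hζ'
      _ < 1 / 4 * (2 / ρ) := by gcongr
      _ = _ := by ring
  have htri : ‖h 0‖ ≤ ‖h T₁ - h 0‖ + ‖h T₂ - h T₁‖ + ‖h T₂‖ := by
    have e : h 0 = -(h T₁ - h 0) + -(h T₂ - h T₁) + h T₂ := by ring
    calc ‖h 0‖ = ‖-(h T₁ - h 0) + -(h T₂ - h T₁) + h T₂‖ := by rw [← e]
      _ ≤ ‖-(h T₁ - h 0)‖ + ‖-(h T₂ - h T₁)‖ + ‖h T₂‖ := norm_add₃_le
      _ = _ := by rw [norm_neg, norm_neg]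
  linarith

end SearchInstance

end SpatialSearch

theorem theorem1 :
    ∃ c₀ : ℝ, 0 < c₀ ∧ ∀ c : ℝ, 0 < c → c ≤ c₀ →
      ∀ X : ℕ → SpatialSearch.SearchInstance,
        (∀ k, 0 < (X k).eps) →
        (∀ k, (X k).SpectralCondition c) →
        (SpatialSearch.IsOptimal X ↔
          (fun k => (X k).S 1 / √((X k).S 2)) =Θ[atTop] (fun _ => (1 : ℝ))) := by
  -- The comparison constants below may depend on `c`, so no smallness of `c` is required.
  refine ⟨1, one_pos, fun c hc _ X hε hX => ?_⟩
  have hS1 := fun k => (X k).S_one_pos hc (hX k)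
  have hS2 : ∀ k, 0 < (X k).S 2 := fun k =>
    lt_of_lt_of_le (pow_pos (hS1 k) 2) (X k).S_one_sq_le
  have hρ : ∀ k, 0 < (X k).S 1 / √((X k).S 2) := fun k =>
    div_pos (hS1 k) (Real.sqrt_pos.mpr (hS2 k))
  have hρ1 : ∀ k, (X k).S 1 / √((X k).S 2) ≤ 1 := fun k =>
    (div_le_one (Real.sqrt_pos.mpr (hS2 k))).mpr (X k).S_one_le
  have ht : ∀ k, 0 < √(X k).eps := fun k => Real.sqrt_pos.mpr (hε k)
  constructor
  · rintro ⟨r, T, hr, hT, hTΘ, hO⟩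
    refine ⟨IsBigO.of_bound 1 (Eventually.of_forall fun k => ?_), ?_⟩
    · rw [Real.norm_of_nonneg (hρ k).le]
      simpa using hρ1 k
    · obtain ⟨C, hC⟩ := hTΘ.1.bound
      refine hO.2.trans (IsBigO.of_bound ((1 + C) * (2 + 3 * c)) (hC.mono fun k hk => ?_))
      rw [Real.norm_of_nonneg (hT k), Real.norm_of_nonneg (one_div_pos.mpr (ht k)).le,
        mul_one_div, le_div_iff₀ (ht k), mul_comm] at hk
      rw [Real.norm_of_nonneg (hρ k).le, Real.norm_of_nonneg ((X k).overlap_nonneg _ _)]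
      exact (X k).overlap_le hc (hX k) (hε k) (hr k) (hT k) hk
  · rintro ⟨-, hΩ⟩
    choose T hT1 hT2 hT3 using fun k => (X k).exists_overlap_ge (hε k) (hS1 k)
    have hT0 : ∀ k, 0 < T k := fun k =>
      lt_of_lt_of_le (by have := ht k; positivity) (hT1 k)
    obtain ⟨C, hC⟩ := hΩ.bound
    refine ⟨fun k => (X k).S 1, T, hS1, fun k => (hT0 k).le, ⟨?_, ?_⟩, ⟨?_, ?_⟩⟩
    · refine IsBigO.of_bound (2 * C) (hC.mono fun k hk => ?_)
      rw [Real.norm_of_nonneg (hρ k).le, norm_one, ← div_le_iff₀ (hρ k)] at hk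
      rw [Real.norm_of_nonneg (hT0 k).le, Real.norm_of_nonneg (one_div_pos.mpr (ht k)).le]
      refine (hT2 k).trans (mul_le_mul_of_nonneg_right ?_ (one_div_pos.mpr (ht k)).le)
      rw [← mul_one_div]
      linarith
    · refine IsBigO.of_bound 8 (Eventually.of_forall fun k => ?_)
      rw [Real.norm_of_nonneg (hT0 k).le, Real.norm_of_nonneg (one_div_pos.mpr (ht k)).le]
      linarith [hT1 k]
    · refine IsBigO.of_bound 1 (Eventually.of_forall fun k => ?_)
      rw [Real.norm_of_nonneg ((X k).overlap_nonneg _ _)]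
      simpa using (X k).overlap_le_one ((X k).S 1) (T k)
    · refine hΩ.trans (IsBigO.of_bound 16 (Eventually.of_forall fun k => ?_))
      rw [Real.norm_of_nonneg (hρ k).le, Real.norm_of_nonneg ((X k).overlap_nonneg _ _)]
      linarith [hT3 k]
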